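/- Let $a<b$ be real, $m\ge 1$ an integer, and $k\in L^2((a,b)^2)$ a real kernel such that the integral operator $(Kx)(s)=\int_a^b k(s,t)x(t)\,dt$ maps $L^2(a,b)$ into the Sobolev space $H^m(a,b)$; point values of $Kx$ on $[a,b]$ are those of its continuous representative. Let $B\in\mathbb R$ and $c_1,c_2>0$. Then there is a constant $C>0$, depending only on $a,b,m,k,B,c_1,c_2$, such that the following holds. Let $n\ge 1$ and let $a\le s_1<\dots<s_n\le b$ be quasi-uniform with constant $B$, i.e. $\max_{t\in[a,b]}\min_i|t-s_i|\le B\,|s_i-s_j|$ for all $i\ne j$. Let $y\in C([a,b])$ belong to the range of $K$, and let $x^\dagger\ne 0$ be the best-approximate solution (least-squares solution of minimal $L^2$-norm) of $Kx=y$. Let $\sigma>0$ and let $e_1,\dots,e_n$ be independent real random variables with $\mathbb E[e_i]=0$, $\mathbb E[e_i^2]<\infty$ and $\operatorname{Var}[e_i]\le\sigma^2$. Put $w_i=y(s_i)+e_i$ and $|u|_n^2=\frac1n\sum_{i=1}^n u_i^2$ for $u\in\mathbb R^n$; a function $u$ is identified here with the vector $(u(s_i))_i$. For $\alpha>0$ let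 $x_{n,\alpha}$ be the minimizer over $x\in L^2(a,b)$ of $|Kx-w|_n^2+\alpha\|x\|^2$, where $\|\cdot\|$ is the norm of $L^2(a,b)$. If $\alpha>0$ is chosen a priori of the order $$c_1\,\sigma n^{-1/2}\|x^\dagger\|^{-1}\;\le\;\alpha^{\frac12+\frac1{4m}}\;\le\;c_2\,\sigma n^{-1/2}\|x^\dagger\|^{-1},$$ then $|Kx_{n,\alpha}-Kx^\dagger|_n^2$ is integrable and $$\mathbb E\big[|Kx_{n,\alpha}-Kx^\dagger|_n^2\big]\;\le\;C\,\big(\sigma n^{-1/2}\big)^{\frac{4m}{1+2m}}\,\|x^\dagger\|^{\frac{2}{1+2m}}.$$ -/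

import Mathlib

open MeasureTheory ProbabilityTheory Set
open scoped ContDiff

noncomputable section

namespace Fredholm

/-- Lebesgue measure on the interval `(a, b)`. -/
abbrev lebesgueIoo (a b : ℝ) : Measure ℝ := volume.restrict (Ioo a b)

/-- The real Hilbert space `L²(a, b)`. -/
abbrev L2 (a b : ℝ) : Type := Lp ℝ 2 (lebesgueIoo a b)

/-- `g` is the weak derivative of order `j` of `f` on `(a, b)`:
`∫ f φ⁽ʲ⁾ = (-1)ʲ ∫ g φ` for all test functions `φ ∈ C_c^∞(a, b)`. -/
def HasWeakDeriv (a b : ℝ) (j : ℕ) (f g : ℝ → ℝ) : Prop :=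
  ∀ φ : ℝ → ℝ, ContDiff ℝ ∞ φ → HasCompactSupport φ → tsupport φ ⊆ Ioo a b →
    ∫ t in Ioo a b, f t * iteratedDeriv j φ t = (-1) ^ j * ∫ t in Ioo a b, g t * φ t

/-- `f` belongs to the Sobolev space `H^m(a, b)`: it is in `L²(a, b)` and so are its weak
derivatives of all orders up to `m`. -/
def MemSobolev (a b : ℝ) (m : ℕ) (f : ℝ → ℝ) : Prop :=
  MemLp f 2 (lebesgueIoo a b) ∧
    ∀ j ≤ m, ∃ g : ℝ → ℝ, MemLp g 2 (lebesgueIoo a b) ∧ HasWeakDeriv a b j f g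

/-- The Fredholm integral operator `(Kx)(s) = ∫_a^b k(s, t) x(t) dt` on `L²(a, b)`. -/
def fredholm (a b : ℝ) (k : ℝ → ℝ → ℝ) (x : L2 a b) : ℝ → ℝ :=
  fun s => ∫ t in Ioo a b, k s t * x t

open Classical in
/-- The continuous representative on `[a, b]` of the class of `f` modulo null sets of `(a, b)`.
For `a < b` its values on `[a, b]` are uniquely determined when it exists, as it does for all
`f ∈ H^m(a, b)` with `m ≥ 1`. (Where none exists, the value is `f` itself.) -/
def contRep (a b : ℝ) (f : ℝ → ℝ) : ℝ → ℝ :=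
  if h : ∃ g : ℝ → ℝ, ContinuousOn g (Icc a b) ∧ g =ᵐ[lebesgueIoo a b] f then h.choose else f

/-- The vector `((Kx)(s₁), …, (Kx)(sₙ))` of point values of `Kx`, which are those of its
continuous representative. -/
def sample (a b : ℝ) (k : ℝ → ℝ → ℝ) {n : ℕ} (s : Fin n → ℝ) (x : L2 a b) : Fin n → ℝ :=
  fun i => contRep a b (fredholm a b k x) (s i)

/-- The empirical semi-norm `|u|_n = (n⁻¹ ∑ uᵢ²)^{1/2}`, of the vector of point values. -/
def empNorm {n : ℕ} (u : Fin n → ℝ) : ℝ :=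
  Real.sqrt ((1 / (n : ℝ)) * ∑ i, u i ^ 2)

/-- The Tikhonov functional `J(x) = |Kx - w|_n² + α ‖x‖²`. -/
def tikhonov (a b : ℝ) (k : ℝ → ℝ → ℝ) {n : ℕ} (s : Fin n → ℝ) (α : ℝ) (w : Fin n → ℝ)
    (x : L2 a b) : ℝ :=
  empNorm (sample a b k s x - w) ^ 2 + α * ‖x‖ ^ 2

/-- The regularized solution `x_{n,α}`: the minimizer over `L²(a, b)` of the Tikhonov
functional with data vector `w`. -/
def regSolution (a b : ℝ) (k : ℝ → ℝ → ℝ) {n : ℕ} (s : Fin n → ℝ) (α : ℝ) (w : Fin n → ℝ) :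
    L2 a b :=
  Classical.epsilon fun x => ∀ z : L2 a b, tikhonov a b k s α w x ≤ tikhonov a b k s α w z

/-- `x` is a least-squares solution in `L²(a, b)` of `Kx = y`. -/
def IsLeastSquaresSolution (a b : ℝ) (k : ℝ → ℝ → ℝ) (y : ℝ → ℝ) (x : L2 a b) : Prop :=
  ∀ z : L2 a b, eLpNorm (fredholm a b k x - y) 2 (lebesgueIoo a b) ≤
    eLpNorm (fredholm a b k z - y) 2 (lebesgueIoo a b)

/-- `x` is the best-approximate solution `x† = K† y` of `Kx = y`: the least-squares solution
of minimal norm. -/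
def IsBestApproxSolution (a b : ℝ) (k : ℝ → ℝ → ℝ) (y : ℝ → ℝ) (x : L2 a b) : Prop :=
  IsLeastSquaresSolution a b k y x ∧
    ∀ z : L2 a b, IsLeastSquaresSolution a b k y z → ‖x‖ ≤ ‖z‖

/-- `h_max = max_{t ∈ [a, b]} min_i |t - sᵢ|`. -/
def hMax (a b : ℝ) {n : ℕ} (s : Fin n → ℝ) : ℝ :=
  ⨆ t : Icc a b, ⨅ i, |(t : ℝ) - s i|

/-- The points `a ≤ s₁ < ⋯ < sₙ ≤ b` are quasi-uniform with constant `B`: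
`h_max / h_min ≤ B` with `h_min = min_{i ≠ j} |sᵢ - sⱼ|`. -/
def QuasiUniform (a b B : ℝ) {n : ℕ} (s : Fin n → ℝ) : Prop :=
  StrictMono s ∧ (∀ i, s i ∈ Icc a b) ∧ ∀ i j, i ≠ j → hMax a b s ≤ B * |s i - s j|

end Fredholm

end

/-! Put `R x = n^{-1/2} ((Kx)(s_i))_i`, so that the empirical norm becomes a Euclidean norm. The
Tikhonov minimizer is linear in the data, `w ↦ X w`, hence the error splits as `c + ∑ e_i f_i`: a
deterministic bias `c = R X R x† - R x†`, and noise with `f_i = n^{-1/2} R X ε_i`, where `ε_i` is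
the standard basis. Independence and centring give the bound `‖c‖² + σ² ∑ ‖f_i‖²` for the expected
squared error (`integral_norm_add_sq_le`). Comparing the minimizer for exact data with `x†` itself
yields `‖c‖² ≤ α ‖x†‖²`.

The variance is governed by the effective dimension `∑ ‖R X ε_i‖²`, a squared Hilbert-Schmidt norm.
A subspace `W` contributes at most its dimension, because `R X` is a contraction; the rest
contributes at most `δ²/(4α)` if `|Kx| ≤ δ ‖x‖` pointwise on `Wᗮ` (`sum_norm_sq_tikhonov_le`).
Smoothness of `Kx` supplies `W`: if all derivatives of order below `m` vanish at `N + 1` equally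
spaced points, which is `m (N + 1)` linear conditions on `x`, then `Kx` is `O(N^{-(m - 1/2)}) ‖x‖`
uniformly (`exists_evaluation_operator`). This needs `x ↦ (Kx)^{(j)}` to be continuous, which the
closed graph theorem provides. With `N` of order `α^{-1/(2m)}` the effective dimension is
`O(α^{-1/(2m)})`.

The prescribed `α` makes the variance at most a constant multiple of the bias bound, which then has
the asserted rate (`bias_add_variance_le`). -/

noncomputable section

namespace Fredholm

open scoped InnerProductSpace

/-! ### Tikhonov regularization with finite-dimensional data, and its effective dimension -/

section Tikhonov

variable {H E : Type*} [NormedAddCommGroup H] [InnerProductSpace ℝ H] [CompleteSpace H]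
  [NormedAddCommGroup E] [InnerProductSpace ℝ E] [FiniteDimensional ℝ E]

/-- The Tikhonov problem for an operator of finite rank has a unique solution `X w`, which depends
linearly on the data, and the functional grows quadratically around it. -/
theorem exists_tikhonov_solution (R : H →L[ℝ] E) {α : ℝ} (hα : 0 < α) :
    ∃ X : E →L[ℝ] H,
      (∀ w z, ‖R z - w‖ ^ 2 + α * ‖z‖ ^ 2 = ‖R (X w) - w‖ ^ 2 + α * ‖X w‖ ^ 2 +
        (‖R (z - X w)‖ ^ 2 + α * ‖z - X w‖ ^ 2)) ∧
      ∀ w, ‖R (X w)‖ ^ 2 + α * ‖X w‖ ^ 2 = ⟪R (X w), w⟫_ℝ := by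
  have : CompleteSpace E := FiniteDimensional.complete ℝ E
  let A := ContinuousLinearMap.adjoint R
  -- The dual form `X = R* (R R* + α)⁻¹` requires inverting only an endomorphism of the
  -- finite-dimensional `E`, for which injectivity is enough.
  let S : E →ₗ[ℝ] E := ((R ∘L A) + α • ContinuousLinearMap.id ℝ E : E →L[ℝ] E)
  have hS : ∀ u, S u = R (A u) + α • u := fun u => rfl
  have hinj : Function.Injective S := by
    rw [← LinearMap.ker_eq_bot, LinearMap.ker_eq_bot']
    intro u hu
    have h1 : ⟪S u, u⟫_ℝ = ‖A u‖ ^ 2 + α * ‖u‖ ^ 2 := by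
      rw [hS, inner_add_left, real_inner_smul_left, ← real_inner_self_eq_norm_sq u,
        ← real_inner_self_eq_norm_sq (A u), ContinuousLinearMap.adjoint_inner_right]
    rw [hu, inner_zero_left] at h1
    have h2 : ‖u‖ ^ 2 = 0 := by nlinarith [sq_nonneg ‖A u‖, sq_nonneg ‖u‖]
    simpa using h2
  let Se := LinearEquiv.ofInjectiveEndo S hinj
  have hSe : ∀ w, S (Se.symm w) = w := fun w => Se.apply_symm_apply w
  let X : E →L[ℝ] H := A ∘L (LinearMap.toContinuousLinearMap (Se.symm : E →ₗ[ℝ] E))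
  have hX : ∀ w, X w = A (Se.symm w) := fun w => rfl
  have hnormal : ∀ w d, ⟪R (X w) - w, R d⟫_ℝ + α * ⟪X w, d⟫_ℝ = 0 := by
    intro w d
    have h := hSe w
    rw [hS, ← hX] at h
    have h1 : R (X w) - w = -(α • Se.symm w) := by
      rw [eq_neg_iff_add_eq_zero, sub_add_eq_add_sub, h, sub_self]
    rw [h1, inner_neg_left, real_inner_smul_left, hX, ContinuousLinearMap.adjoint_inner_left]
    ring
  refine ⟨X, fun w z => ?_, fun w => ?_⟩
  · have h := hnormal w (z - X w)
    have e1 : R z - w = (R (X w) - w) + R (z - X w) := by rw [map_sub]; abel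
    have e2 : ‖z‖ ^ 2 = ‖X w + (z - X w)‖ ^ 2 := by congr 2; abel
    rw [e1, e2, norm_add_sq_real, norm_add_sq_real]
    linarith
  · have h := hnormal w (X w)
    rw [inner_sub_left, real_inner_self_eq_norm_sq, real_inner_self_eq_norm_sq,
      real_inner_comm] at h
    linarith [real_inner_comm w (R (X w))]

/-- Both sums are the trace of `L* L`. -/
theorem sum_norm_sq_eq_of_orthonormalBasis {ι κ F : Type*} [Fintype ι] [Fintype κ]
    [NormedAddCommGroup F] [InnerProductSpace ℝ F] [CompleteSpace F] (L : E →L[ℝ] F)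
    (b : OrthonormalBasis ι ℝ E) (c : OrthonormalBasis κ ℝ E) :
    ∑ i, ‖L (b i)‖ ^ 2 = ∑ i, ‖L (c i)‖ ^ 2 := by
  classical
  have : CompleteSpace E := FiniteDimensional.complete ℝ E
  let T : E →ₗ[ℝ] E := ((ContinuousLinearMap.adjoint L) ∘L L : E →L[ℝ] E)
  have key : ∀ u, ‖L u‖ ^ 2 = ⟪u, T u⟫_ℝ := fun u => by
    rw [← real_inner_self_eq_norm_sq]
    exact (ContinuousLinearMap.adjoint_inner_right L u (L u)).symm
  simp only [key]
  rw [← LinearMap.trace_eq_sum_inner T b, ← LinearMap.trace_eq_sum_inner T c]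

/-- Any finite-dimensional subspace is spanned by part of an orthonormal basis. -/
theorem exists_orthonormalBasis_adapted (V : Submodule ℝ E) :
    ∃ (u v : Finset E) (b : OrthonormalBasis u ℝ E), v.card = Module.finrank ℝ V ∧
      ∀ i : u, (i : E) ∉ v → ∀ x ∈ V, ⟪x, b i⟫_ℝ = 0 := by
  classical
  let c := stdOrthonormalBasis ℝ V
  have hc : Orthonormal ℝ (fun i => (c i : E)) :=
    c.orthonormal.comp_linearIsometry V.subtypeₗᵢ
  have hinj : Function.Injective (fun i => (c i : E)) := hc.linearIndependent.injective
  obtain ⟨u, b, hu, hb⟩ := hc.toSubtypeRange.exists_orthonormalBasis_extension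
  refine ⟨u, Finset.univ.image (fun i => (c i : E)), b, ?_, ?_⟩
  · rw [Finset.card_image_of_injective _ hinj]; simp
  · intro i hi x hx
    have h1 : ∀ l, ⟪(c l : E), b i⟫_ℝ = 0 := by
      intro l
      have hl : (c l : E) ∈ u := hu (mem_range_self l)
      have h2 : b ⟨c l, hl⟩ = (c l : E) := by rw [hb]
      rw [← h2]
      refine b.orthonormal.2 ?_
      rintro rfl
      exact hi (Finset.mem_image.2 ⟨l, Finset.mem_univ _, rfl⟩)
    have h3 : x = ∑ l, ⟪c l, (⟨x, hx⟩ : V)⟫_ℝ • (c l : E) := by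
      have := congrArg (Subtype.val) (c.sum_repr' ⟨x, hx⟩)
      simpa using this.symm
    rw [h3, sum_inner]
    refine Finset.sum_eq_zero fun l _ => ?_
    rw [real_inner_smul_left, h1, mul_zero]

/-- The effective dimension of the Tikhonov problem is bounded by the dimension of a subspace `W`
plus the contribution of the operator on the orthogonal complement of `W`. -/
theorem sum_norm_sq_tikhonov_le {n : ℕ} (R : H →L[ℝ] EuclideanSpace ℝ (Fin n)) {α : ℝ} (hα : 0 < α)
    (X : EuclideanSpace ℝ (Fin n) →L[ℝ] H)
    (hX : ∀ w, ‖R (X w)‖ ^ 2 + α * ‖X w‖ ^ 2 = ⟪R (X w), w⟫_ℝ)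
    (W : Submodule ℝ H) [FiniteDimensional ℝ W] {δ : ℝ} (hδ : 0 ≤ δ)
    (hW : ∀ x ∈ Wᗮ, ∀ i, |R x i| ≤ δ * ‖x‖) :
    ∑ i, ‖R (X (EuclideanSpace.basisFun (Fin n) ℝ i))‖ ^ 2 ≤
      Module.finrank ℝ W + n * δ ^ 2 / (4 * α) := by
  classical
  let A := ContinuousLinearMap.adjoint R
  let Q : H →L[ℝ] H := Wᗮ.starProjection
  let V : Submodule ℝ (EuclideanSpace ℝ (Fin n)) := W.map (R : H →ₗ[ℝ] _)
  have hV : Module.finrank ℝ V ≤ Module.finrank ℝ W := Submodule.finrank_map_le _ _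
  obtain ⟨u, v, b, hv, hb⟩ := exists_orthonormalBasis_adapted V
  -- On `Wᗮ` the `i`-th coordinate of `R` is represented by `Q A ε_i`; evaluating it at this very
  -- vector bounds its norm.
  have hQA : ∀ i, ‖(Q ∘L A) (EuclideanSpace.basisFun (Fin n) ℝ i)‖ ≤ δ := by
    intro i
    set e := EuclideanSpace.basisFun (Fin n) ℝ i with he
    set q := (Q ∘L A) e with hq
    have hqW : q ∈ Wᗮ := Submodule.starProjection_apply_mem _ _
    have h1 : ‖q‖ ^ 2 = R q i := by
      have h2 : ⟪q, A e⟫_ℝ = ⟪q, q⟫_ℝ := by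
        have := Wᗮ.sub_starProjection_mem_orthogonal (A e)
        have h3 := this q hqW
        rw [inner_sub_right, sub_eq_zero] at h3
        exact h3
      rw [← real_inner_self_eq_norm_sq, ← h2, ContinuousLinearMap.adjoint_inner_right,
        real_inner_comm, he]
      simp [EuclideanSpace.basisFun_apply, EuclideanSpace.inner_single_left]
    have h4 := (le_abs_self _).trans (hW q hqW i)
    by_contra hcon
    push Not at hcon
    nlinarith [norm_nonneg q]
  have hbound1 : ∀ w, ‖R (X w)‖ ^ 2 ≤ ‖w‖ ^ 2 := by
    intro w
    have h1 := hX w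
    have h2 := real_inner_le_norm (R (X w)) w
    nlinarith [sq_nonneg (‖R (X w)‖ - ‖w‖), mul_nonneg hα.le (sq_nonneg ‖X w‖)]
  -- For `w ⟂ R W` the vector `A w` lies in `Wᗮ`. The energy identity then reads `‖R X w‖² + α ‖X
  -- w‖² = ⟪X w, A w⟫`, and the right side is at most `α ‖X w‖² + ‖A w‖² / (4α)`.
  have hbound2 : ∀ w, (∀ x ∈ V, ⟪x, w⟫_ℝ = 0) → ‖R (X w)‖ ^ 2 ≤ ‖(Q ∘L A) w‖ ^ 2 / (4 * α) := by
    intro w hw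
    have hA : A w ∈ Wᗮ := by
      intro x hx
      rw [ContinuousLinearMap.adjoint_inner_right]
      exact hw _ ⟨x, hx, rfl⟩
    have hQ : (Q ∘L A) w = A w := Submodule.starProjection_eq_self_iff.2 hA
    rw [hQ, le_div_iff₀ (by positivity)]
    have h1 := hX w
    rw [← ContinuousLinearMap.adjoint_inner_right] at h1
    have h2 := real_inner_le_norm (X w) (A w)
    nlinarith [sq_nonneg (2 * α * ‖X w‖ - ‖A w‖)]
  have hs1 : ∑ i, ‖R (X (EuclideanSpace.basisFun (Fin n) ℝ i))‖ ^ 2 = ∑ i, ‖R (X (b i))‖ ^ 2 :=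
    sum_norm_sq_eq_of_orthonormalBasis (R ∘L X) _ b
  have hs2 : ∑ i, ‖(Q ∘L A) (b i)‖ ^ 2 =
      ∑ i, ‖(Q ∘L A) (EuclideanSpace.basisFun (Fin n) ℝ i)‖ ^ 2 :=
    sum_norm_sq_eq_of_orthonormalBasis (Q ∘L A) b _
  have hs3 : ∑ i, ‖(Q ∘L A) (b i)‖ ^ 2 ≤ n * δ ^ 2 := by
    rw [hs2]
    calc _ ≤ ∑ _i : Fin n, δ ^ 2 :=
          Finset.sum_le_sum fun i _ => pow_le_pow_left₀ (norm_nonneg _) (hQA i) 2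
      _ = n * δ ^ 2 := by simp
  rw [hs1]
  calc ∑ i, ‖R (X (b i))‖ ^ 2
      ≤ ∑ i : u, ((if (i : EuclideanSpace ℝ (Fin n)) ∈ v then 1 else 0) +
          ‖(Q ∘L A) (b i)‖ ^ 2 / (4 * α)) := by
        refine Finset.sum_le_sum fun i _ => ?_
        split_ifs with hi
        · have h1 := hbound1 (b i)
          rw [b.orthonormal.1 i] at h1
          have : 0 ≤ ‖(Q ∘L A) (b i)‖ ^ 2 / (4 * α) := by positivity
          linarith
        · rw [zero_add]
          exact hbound2 _ (hb i hi)
    _ = (∑ i : u, if (i : EuclideanSpace ℝ (Fin n)) ∈ v then (1 : ℝ) else 0) +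
          (∑ i, ‖(Q ∘L A) (b i)‖ ^ 2) / (4 * α) := by
        rw [Finset.sum_add_distrib, Finset.sum_div]
    _ ≤ _ := by
        have h1 : (∑ i : u, if (i : EuclideanSpace ℝ (Fin n)) ∈ v then (1 : ℝ) else 0) ≤
            Module.finrank ℝ W := by
          rw [Finset.sum_coe_sort u (fun i => if i ∈ v then (1 : ℝ) else 0), ← Finset.sum_filter,
            Finset.sum_const, nsmul_eq_mul, mul_one, Nat.cast_le]
          refine le_trans (Finset.card_le_card fun x hx => (Finset.mem_filter.1 hx).2) ?_
          exact hv.le.trans hV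
        gcongr

end Tikhonov

/-! ### Test functions and weak derivatives on an interval -/

/-- `φ ∈ C_c^∞(a, b)`. -/
def IsTestFunction (a b : ℝ) (φ : ℝ → ℝ) : Prop :=
  ContDiff ℝ ∞ φ ∧ HasCompactSupport φ ∧ tsupport φ ⊆ Ioo a b

namespace IsTestFunction

variable {a b : ℝ} {φ : ℝ → ℝ}

theorem deriv (h : IsTestFunction a b φ) : IsTestFunction a b (deriv φ) :=
  ⟨(contDiff_infty_iff_deriv.1 h.1).2, h.2.1.deriv,
    (closure_minimal support_deriv_subset (isClosed_tsupport φ)).trans h.2.2⟩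

theorem iteratedDeriv (h : IsTestFunction a b φ) (j : ℕ) :
    IsTestFunction a b (iteratedDeriv j φ) := by
  induction j with
  | zero => rwa [iteratedDeriv_zero]
  | succ j ih => rw [iteratedDeriv_succ]; exact ih.deriv

theorem continuous (h : IsTestFunction a b φ) : Continuous φ := h.1.continuous

theorem eq_zero (h : IsTestFunction a b φ) {t : ℝ} (ht : t ∉ Ioo a b) : φ t = 0 :=
  image_eq_zero_of_notMem_tsupport fun h' => ht (h.2.2 h')

theorem exists_bound (h : IsTestFunction a b φ) : ∃ C : ℝ, 0 ≤ C ∧ ∀ t, ‖φ t‖ ≤ C := by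
  obtain ⟨C, hC⟩ := h.2.1.exists_bound_of_continuous h.continuous
  exact ⟨C, (norm_nonneg _).trans (hC 0), hC⟩

theorem integrable (h : IsTestFunction a b φ) : Integrable φ :=
  h.continuous.integrable_of_hasCompactSupport h.2.1

theorem setIntegral_eq (h : IsTestFunction a b φ) : ∫ t in Ioo a b, φ t = ∫ t, φ t :=
  setIntegral_eq_integral_of_forall_compl_eq_zero fun _ ht => h.eq_zero ht

theorem integrableOn_mul (h : IsTestFunction a b φ) {f : ℝ → ℝ} (hf : IntegrableOn f (Ioo a b)) :
    IntegrableOn (fun t => f t * φ t) (Ioo a b) := by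
  obtain ⟨C, -, hC⟩ := h.exists_bound
  exact Integrable.mul_bdd (c := C) hf h.continuous.aestronglyMeasurable (ae_of_all _ hC)

end IsTestFunction

variable {a b : ℝ}

theorem exists_isTestFunction_integral_eq_one (hab : a < b) :
    ∃ ψ, IsTestFunction a b ψ ∧ ∫ t, ψ t = 1 := by
  let β : ContDiffBump ((a + b) / 2) := ⟨(b - a) / 8, (b - a) / 4, by linarith, by linarith⟩
  refine ⟨β.normed volume, ⟨β.contDiff_normed, β.hasCompactSupport_normed, ?_⟩, β.integral_normed⟩
  rw [β.tsupport_normed_eq, Real.closedBall_eq_Icc]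
  refine Icc_subset_Ioo ?_ ?_ <;> simp only [β] <;> linarith

/-- A test function of integral zero is the derivative of a test function. -/
theorem IsTestFunction.exists_primitive {θ : ℝ → ℝ} (hθ : IsTestFunction a b θ)
    (hab : a < b) (h0 : ∫ t, θ t = 0) : ∃ η, IsTestFunction a b η ∧ _root_.deriv η = θ := by
  -- The midpoint is inserted so that the compact set is nonempty even for `θ = 0`.
  have hK : IsCompact (insert ((a + b) / 2) (tsupport θ)) := hθ.2.1.isCompact.insert _
  have hmid : (a + b) / 2 ∈ Ioo a b := ⟨by linarith, by linarith⟩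
  have hKs : insert ((a + b) / 2) (tsupport θ) ⊆ Ioo a b := insert_subset hmid hθ.2.2
  obtain ⟨a', ha', hla⟩ := hK.exists_isLeast (insert_nonempty _ _)
  obtain ⟨b', hb', hgb⟩ := hK.exists_isGreatest (insert_nonempty _ _)
  have hsupp : tsupport θ ⊆ Icc a' b' := fun t ht =>
    ⟨hla (mem_insert_of_mem _ ht), hgb (mem_insert_of_mem _ ht)⟩
  have hz : ∀ t, t ∉ Icc a' b' → θ t = 0 := fun t ht =>
    image_eq_zero_of_notMem_tsupport fun h => ht (hsupp h)
  have haa : a < a' := (hKs ha').1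
  have hbb : b' < b := (hKs hb').2
  let η : ℝ → ℝ := fun t => ∫ τ in a..t, θ τ
  have hd : ∀ t, HasDerivAt η (θ t) t := fun t =>
    intervalIntegral.integral_hasDerivAt_right (hθ.continuous.intervalIntegrable _ _)
      hθ.continuous.stronglyMeasurable.stronglyMeasurableAtFilter hθ.continuous.continuousAt
  have hderiv : _root_.deriv η = θ := funext fun t => (hd t).deriv
  -- To the left of the support nothing has been integrated yet; to the right the integral is the
  -- total one, which is zero.
  have hη0 : ∀ t, t ∉ Icc a' b' → η t = 0 := by
    intro t ht
    rw [mem_Icc, not_and_or, not_le, not_le] at ht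
    rcases ht with ht | ht
    · have : EqOn θ (fun _ => 0) (uIcc a t) := by
        intro τ hτ
        refine hz τ fun hm => ?_
        have := hτ.2
        exact absurd (hm.1.trans this) (not_le.2 (max_lt haa ht))
      simp only [η]
      rw [intervalIntegral.integral_congr this]; simp
    · simp only [η]
      rw [intervalIntegral.integral_eq_integral_of_support_subset, h0]
      intro τ hτ
      have hm : τ ∈ Icc a' b' := by
        by_contra hm; exact hτ (hz τ hm)
      exact ⟨haa.trans_le hm.1, hm.2.trans ht.le⟩
  have hts : tsupport η ⊆ Icc a' b' :=
    closure_minimal (fun t ht => by by_contra hm; exact ht (hη0 t hm)) isClosed_Icc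
  refine ⟨η, ⟨?_, ?_, hts.trans (Icc_subset_Ioo haa hbb)⟩, hderiv⟩
  · rw [contDiff_infty_iff_deriv, hderiv]
    exact ⟨fun t => (hd t).differentiableAt, hθ.1⟩
  · exact HasCompactSupport.of_support_subset_isCompact isCompact_Icc
      ((subset_tsupport η).trans hts)

theorem ae_eq_of_integral_mul_testFunction_eq {f g : ℝ → ℝ} (hf : IntegrableOn f (Ioo a b))
    (hg : IntegrableOn g (Ioo a b)) (h : ∀ φ, IsTestFunction a b φ →
      ∫ t in Ioo a b, f t * φ t = ∫ t in Ioo a b, g t * φ t) : f =ᵐ[lebesgueIoo a b] g := by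
  have h1 : ∀ᵐ t, t ∈ Ioo a b → (f - g) t = 0 := by
    refine isOpen_Ioo.ae_eq_zero_of_integral_contDiff_smul_eq_zero
      (IntegrableOn.locallyIntegrableOn (hf.sub hg)) fun φ h1 h2 h3 => ?_
    have hφ : IsTestFunction a b φ := ⟨h1, h2, h3⟩
    rw [← setIntegral_eq_integral_of_forall_compl_eq_zero (s := Ioo a b)
      (fun t ht => by rw [hφ.eq_zero ht, zero_smul])]
    have h4 := h φ hφ
    rw [← sub_eq_zero, ← integral_sub (hφ.integrableOn_mul hf) (hφ.integrableOn_mul hg)] at h4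
    rw [← h4]
    refine integral_congr_ae (ae_of_all _ fun t => ?_)
    simp only [Pi.sub_apply, smul_eq_mul]; ring
  rw [lebesgueIoo, Filter.EventuallyEq, ae_restrict_iff' measurableSet_Ioo]
  filter_upwards [h1] with t ht htm
  exact sub_eq_zero.1 (ht htm)

/-- The lemma of du Bois-Reymond: a function with vanishing weak derivative is constant. -/
theorem ae_eq_const_of_integral_mul_deriv_eq_zero (hab : a < b) {f : ℝ → ℝ}
    (hf : IntegrableOn f (Ioo a b))
    (h : ∀ φ, IsTestFunction a b φ → ∫ t in Ioo a b, f t * deriv φ t = 0) :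
    ∃ c : ℝ, f =ᵐ[lebesgueIoo a b] fun _ => c := by
  obtain ⟨ψ, hψ, hψ1⟩ := exists_isTestFunction_integral_eq_one hab
  refine ⟨∫ t in Ioo a b, f t * ψ t, ae_eq_of_integral_mul_testFunction_eq hf
    (integrableOn_const (by simp)) fun φ hφ => ?_⟩
  -- Subtracting `(∫ φ) ψ` makes the integral zero, so the difference is the derivative of a test
  -- function and is annihilated by `f`.
  have hθ : IsTestFunction a b (fun t => φ t - (∫ t, φ t) * ψ t) := by
    refine ⟨hφ.1.sub (contDiff_const.mul hψ.1), hφ.2.1.sub hψ.2.1.mul_left, ?_⟩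
    refine (closure_mono ?_).trans ((closure_union (s := Function.support φ)
      (t := Function.support ψ)).subset.trans (union_subset hφ.2.2 hψ.2.2))
    intro t ht
    by_contra hcon
    simp only [mem_union, Function.mem_support, not_or, not_not] at hcon
    exact ht (by simp [hcon.1, hcon.2])
  obtain ⟨η, hη, hd⟩ := hθ.exists_primitive hab (by
    rw [integral_sub hφ.integrable (hψ.integrable.const_mul _), integral_const_mul, hψ1]; simp)
  have h1 := h η hη
  rw [hd] at h1
  have h2 : ∫ t in Ioo a b, f t * (φ t - (∫ t, φ t) * ψ t) =
      (∫ t in Ioo a b, f t * φ t) - (∫ t, φ t) * ∫ t in Ioo a b, f t * ψ t := by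
    rw [← integral_const_mul, ← integral_sub (hφ.integrableOn_mul hf)
      ((hψ.integrableOn_mul hf).const_mul _)]
    refine integral_congr_ae (ae_of_all _ fun t => ?_)
    dsimp only; ring
  rw [integral_const_mul, hφ.setIntegral_eq]
  linarith [h2.symm.trans h1]

/-- A primitive of an integrable function is absolutely continuous and has that function as
derivative almost everywhere. Integration by parts applies, and `φ` vanishes at both end points. -/
theorem integral_primitive_mul_deriv (hab : a < b) {g : ℝ → ℝ} (hg : IntegrableOn g (Ioo a b))
    {φ : ℝ → ℝ} (hφ : IsTestFunction a b φ) :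
    ∫ t in Ioo a b, (∫ τ in a..t, g τ) * deriv φ t = - ∫ t in Ioo a b, g t * φ t := by
  have hgi : IntervalIntegrable g volume a b :=
    (intervalIntegrable_iff_integrableOn_Ioo_of_le hab.le).2 hg
  have h1 := (hgi.absolutelyContinuousOnInterval_intervalIntegral
    (left_mem_uIcc)).integral_mul_deriv_eq_deriv_mul
      ((hφ.1.of_le (by simp)).contDiffOn.absolutelyContinuousOnInterval (f := φ))
  rw [hφ.eq_zero (t := a) (by simp), hφ.eq_zero (t := b) (by simp)] at h1
  rw [← integral_Ioc_eq_integral_Ioo, ← integral_Ioc_eq_integral_Ioo,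
    ← intervalIntegral.integral_of_le hab.le, ← intervalIntegral.integral_of_le hab.le, h1]
  rw [mul_zero, mul_zero, sub_zero, zero_sub, neg_inj]
  refine intervalIntegral.integral_congr_ae ?_
  filter_upwards [hgi.ae_hasDerivAt_integral] with t ht htm
  rw [(ht (uIoc_subset_uIcc htm) a left_mem_uIcc).deriv]

/-- A function with an integrable weak derivative is a primitive of it. -/
theorem exists_ae_eq_add_integral (hab : a < b) {f g : ℝ → ℝ} (hf : IntegrableOn f (Ioo a b))
    (hg : IntegrableOn g (Ioo a b)) (h : ∀ φ, IsTestFunction a b φ →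
      ∫ t in Ioo a b, f t * deriv φ t = - ∫ t in Ioo a b, g t * φ t) :
    ∃ c : ℝ, f =ᵐ[lebesgueIoo a b] fun t => c + ∫ τ in a..t, g τ := by
  have hgi : IntervalIntegrable g volume a b :=
    (intervalIntegrable_iff_integrableOn_Ioo_of_le hab.le).2 hg
  have hG : IntegrableOn (fun t => ∫ τ in a..t, g τ) (Ioo a b) := by
    have h1 := intervalIntegral.continuousOn_primitive_interval'
      hgi (left_mem_uIcc)
    rw [uIcc_of_le hab.le] at h1
    exact (h1.integrableOn_Icc).mono_set Ioo_subset_Icc_self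
  obtain ⟨c, hc⟩ := ae_eq_const_of_integral_mul_deriv_eq_zero hab (hf.sub hG) (fun φ hφ => by
    have h1 := integral_primitive_mul_deriv hab hg hφ
    have h2 := h φ hφ
    calc _ = ∫ t in Ioo a b, (f t * deriv φ t - (∫ τ in a..t, g τ) * deriv φ t) := by
          refine integral_congr_ae (ae_of_all _ fun t => ?_)
          simp only [Pi.sub_apply]; ring
      _ = 0 := by
          rw [integral_sub (hφ.deriv.integrableOn_mul hf) (hφ.deriv.integrableOn_mul hG), h1, h2,
            sub_self])
  refine ⟨c, ?_⟩
  filter_upwards [hc] with t ht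
  simp only [Pi.sub_apply] at ht
  linarith

/-- Testing the relation of order `j` with `φ'` produces the same left side as testing that of order
`j + 1` with `φ`. Thus the weak derivatives form a chain of first-order ones. -/
theorem HasWeakDeriv.succ {f g g' : ℝ → ℝ} {j : ℕ} (h : HasWeakDeriv a b j f g)
    (h' : HasWeakDeriv a b (j + 1) f g') {φ : ℝ → ℝ} (hφ : IsTestFunction a b φ) :
    ∫ t in Ioo a b, g t * deriv φ t = - ∫ t in Ioo a b, g' t * φ t := by
  have h1 := h _ hφ.deriv.1 hφ.deriv.2.1 hφ.deriv.2.2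
  have h2 := h' _ hφ.1 hφ.2.1 hφ.2.2
  rw [iteratedDeriv_succ'] at h2
  rw [h2, pow_succ, mul_assoc] at h1
  have := mul_left_cancel₀ (pow_ne_zero j (by norm_num : (-1 : ℝ) ≠ 0)) h1
  linarith

/-! ### Continuity by the closed graph theorem, and the functionals it needs -/

/-- A map into a Banach space is linear and continuous if it is so weakly with respect to a
separating family of continuous functionals. -/
theorem exists_continuousLinearMap_of_separating {H F ι : Type*} [NormedAddCommGroup H]
    [NormedSpace ℝ H] [CompleteSpace H] [NormedAddCommGroup F] [NormedSpace ℝ F] [CompleteSpace F]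
    (l : ι → F →L[ℝ] ℝ) (hl : ∀ v, (∀ i, l i v = 0) → v = 0) (Λ : ι → H →L[ℝ] ℝ) (T : H → F)
    (h : ∀ i x, l i (T x) = Λ i x) : ∃ T' : H →L[ℝ] F, ∀ x, T' x = T x := by
  have hext : ∀ u v, (∀ i, l i u = l i v) → u = v := fun u v huv =>
    sub_eq_zero.1 (hl _ fun i => by rw [map_sub, huv, sub_self])
  let T₀ : H →ₗ[ℝ] F :=
    { toFun := T
      map_add' := fun x y => hext _ _ fun i => by rw [map_add, h, h, h, map_add]
      map_smul' := fun c x => hext _ _ fun i => by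
        rw [RingHom.id_apply, map_smul, h, h, map_smul] }
  -- As the `l i` separate points, the graph is cut out by the closed conditions `l i p.2 = Λ i
  -- p.1`.
  have hclosed : IsClosed (T₀.graph : Set (H × F)) := by
    have : (T₀.graph : Set (H × F)) = ⋂ i, {p : H × F | l i p.2 = Λ i p.1} := by
      ext p
      simp only [SetLike.mem_coe, LinearMap.mem_graph_iff, mem_iInter, mem_ofPred_eq]
      constructor
      · intro hp i
        rw [hp]
        exact h i p.1
      · intro hp
        exact hext _ _ fun i => (hp i).trans (h i p.1).symm
    rw [this]
    exact isClosed_iInter fun i => isClosed_eq ((l i).continuous.comp continuous_snd)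
      ((Λ i).continuous.comp continuous_fst)
  exact ⟨ContinuousLinearMap.ofIsClosedGraph hclosed, fun x => rfl⟩

theorem continuousOn_eq_of_ae_eq (hab : a < b) {f g : ℝ → ℝ} (hf : ContinuousOn f (Icc a b))
    (hg : ContinuousOn g (Icc a b)) (h : f =ᵐ[lebesgueIoo a b] g) : EqOn f g (Icc a b) := by
  refine Measure.eqOn_Icc_of_ae_eq (μ := volume) hab.ne ?_ hf hg
  rwa [← Measure.restrict_congr_set Ioo_ae_eq_Icc]

theorem contRep_eqOn (hab : a < b) {f g : ℝ → ℝ} (hg : ContinuousOn g (Icc a b))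
    (h : g =ᵐ[lebesgueIoo a b] f) : EqOn (contRep a b f) g (Icc a b) := by
  have hex : ∃ g : ℝ → ℝ, ContinuousOn g (Icc a b) ∧ g =ᵐ[lebesgueIoo a b] f := ⟨g, hg, h⟩
  rw [contRep, dif_pos hex]
  exact continuousOn_eq_of_ae_eq hab hex.choose_spec.1 hg (hex.choose_spec.2.trans h.symm)

/-- Writing the pairing as an inner product makes linearity in `x` and the Cauchy-Schwarz inequality
available. -/
theorem abs_integral_mul_le (f : ℝ → ℝ) (hf : MemLp f 2 (lebesgueIoo a b)) (x : L2 a b) :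
    Integrable (fun t => f t * x t) (lebesgueIoo a b) ∧
    ∫ t in Ioo a b, f t * x t = ⟪x, hf.toLp f⟫_ℝ := by
  refine ⟨hf.integrable_mul (Lp.memLp x), ?_⟩
  rw [L2.inner_def]
  refine integral_congr_ae ?_
  filter_upwards [hf.coeFn_toLp] with t ht
  rw [ht]; rfl

section Functional

variable {k : ℝ → ℝ → ℝ}

theorem ae_memLp_kernel (hk : MemLp (Function.uncurry k) 2
    ((lebesgueIoo a b).prod (lebesgueIoo a b))) :
    (∀ᵐ s ∂lebesgueIoo a b, MemLp (k s) 2 (lebesgueIoo a b)) ∧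
      Integrable (fun s => ∫ t in Ioo a b, k s t ^ 2) (lebesgueIoo a b) := by
  have h1 := (memLp_two_iff_integrable_sq hk.1).1 hk
  refine ⟨?_, h1.integral_prod_left⟩
  filter_upwards [h1.prod_right_ae, hk.1.prodMk_left] with s hs hs'
  exact (memLp_two_iff_integrable_sq hs').2 hs

/-- Cauchy-Schwarz gives the factor `‖k s‖`; it is relaxed to `1 + ‖k s‖²`, whose integrability in
`s` is immediate from `k ∈ L²`. -/
theorem abs_fredholm_le {s : ℝ} (hs : MemLp (k s) 2 (lebesgueIoo a b)) (x : L2 a b) :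
    |fredholm a b k x s| ≤ (1 + ∫ t in Ioo a b, k s t ^ 2) * ‖x‖ := by
  have h1 : ‖hs.toLp (k s)‖ ^ 2 = ∫ t in Ioo a b, k s t ^ 2 := by
    rw [← real_inner_self_eq_norm_sq, ← (abs_integral_mul_le (k s) hs _).2]
    refine integral_congr_ae ?_
    filter_upwards [hs.coeFn_toLp] with t ht
    rw [ht, sq]
  rw [fredholm, (abs_integral_mul_le (k s) hs x).2, ← h1, mul_comm]
  refine (abs_real_inner_le_norm _ _).trans (mul_le_mul_of_nonneg_left ?_ (norm_nonneg _))
  nlinarith [sq_nonneg (‖hs.toLp (k s)‖ - 1), norm_nonneg (hs.toLp (k s))]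

/-- Integration of `Kx` against a test function is a continuous functional of `x`. -/
theorem exists_functional (hk : MemLp (Function.uncurry k) 2
    ((lebesgueIoo a b).prod (lebesgueIoo a b)))
    (hK : ∀ x : L2 a b, IntegrableOn (fredholm a b k x) (Ioo a b))
    {φ : ℝ → ℝ} (hφ : IsTestFunction a b φ) :
    ∃ Λ : L2 a b →L[ℝ] ℝ, ∀ x, Λ x = ∫ s in Ioo a b, fredholm a b k x s * φ s := by
  obtain ⟨hk1, hk2⟩ := ae_memLp_kernel hk
  obtain ⟨C, hC0, hC⟩ := hφ.exists_bound
  let Λ₀ : L2 a b →ₗ[ℝ] ℝ :=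
    { toFun := fun x => ∫ s in Ioo a b, fredholm a b k x s * φ s
      map_add' := fun x y => by
        rw [← integral_add (hφ.integrableOn_mul (hK x)) (hφ.integrableOn_mul (hK y))]
        refine integral_congr_ae ?_
        filter_upwards [hk1] with s hs
        rw [← add_mul, fredholm, (abs_integral_mul_le _ hs _).2, fredholm,
          (abs_integral_mul_le _ hs _).2, fredholm, (abs_integral_mul_le _ hs _).2, inner_add_left]
      map_smul' := fun c x => by
        rw [RingHom.id_apply, smul_eq_mul, ← integral_const_mul]
        refine integral_congr_ae ?_
        filter_upwards [hk1] with s hs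
        rw [← mul_assoc, fredholm, (abs_integral_mul_le _ hs _).2, fredholm,
          (abs_integral_mul_le _ hs _).2, real_inner_smul_left] }
  refine ⟨Λ₀.mkContinuous (∫ s in Ioo a b, (1 + ∫ t in Ioo a b, k s t ^ 2) * C) fun x => ?_,
    fun x => rfl⟩
  rw [← integral_mul_const]
  refine norm_integral_le_of_norm_le ?_ ?_
  · exact (((integrable_const 1).add hk2).mul_const C).mul_const _
  · filter_upwards [hk1] with s hs
    rw [norm_mul]
    calc _ ≤ ((1 + ∫ t in Ioo a b, k s t ^ 2) * ‖x‖) * C :=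
          mul_le_mul (abs_fredholm_le hs x) (hC s) (norm_nonneg _)
            ((abs_nonneg _).trans (abs_fredholm_le hs x))
      _ = _ := by ring

end Functional

section Continuous

/-- Integration against a test function, as a functional on `C([a, b])`. -/
theorem exists_functional_continuousMap (hab : a < b) {φ : ℝ → ℝ} (hφ : IsTestFunction a b φ) :
    ∃ l : C(Icc a b, ℝ) →L[ℝ] ℝ, ∀ v, l v = ∫ t in Ioo a b, v (projIcc a b hab.le t) * φ t := by
  have hint : ∀ v : C(Icc a b, ℝ), IntegrableOn (fun t => v (projIcc a b hab.le t)) (Ioo a b) :=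
    fun v => ((v.continuous.comp continuous_projIcc).integrableOn_Icc).mono_set
      Ioo_subset_Icc_self
  let l₀ : C(Icc a b, ℝ) →ₗ[ℝ] ℝ :=
    { toFun := fun v => ∫ t in Ioo a b, v (projIcc a b hab.le t) * φ t
      map_add' := fun v w => by
        rw [← integral_add (hφ.integrableOn_mul (hint v)) (hφ.integrableOn_mul (hint w))]
        simp only [ContinuousMap.add_apply, add_mul]
      map_smul' := fun c v => by
        rw [RingHom.id_apply, smul_eq_mul, ← integral_const_mul]
        simp only [ContinuousMap.smul_apply, smul_eq_mul, mul_assoc] }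
  refine ⟨l₀.mkContinuous (∫ t in Ioo a b, ‖φ t‖) fun v => ?_, fun v => rfl⟩
  rw [← integral_mul_const]
  refine norm_integral_le_of_norm_le (hφ.integrable.norm.integrableOn.mul_const _)
    (ae_of_all _ fun t => ?_)
  rw [norm_mul, mul_comm]
  exact mul_le_mul_of_nonneg_left (v.norm_coe_le_norm _) (norm_nonneg _)

/-- This is the separation property that the closed graph argument asks of test-function functionals
on `C([a, b])`. -/
theorem continuousMap_eq_zero_of_integral (hab : a < b) (v : C(Icc a b, ℝ))
    (h : ∀ φ, IsTestFunction a b φ → ∫ t in Ioo a b, v (projIcc a b hab.le t) * φ t = 0) :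
    v = 0 := by
  have hc : Continuous fun t => v (projIcc a b hab.le t) := v.continuous.comp continuous_projIcc
  have h1 := ae_eq_of_integral_mul_testFunction_eq (a := a) (b := b) (g := fun _ => 0)
    (hc.integrableOn_Icc.mono_set Ioo_subset_Icc_self) (integrable_zero _ _ _)
    (fun φ hφ => by simpa using h φ hφ)
  ext t
  have h2 := continuousOn_eq_of_ae_eq hab hc.continuousOn continuousOn_const h1 t.2
  simpa using h2

theorem exists_functional_L2 {φ : ℝ → ℝ} (hφ : IsTestFunction a b φ) :
    ∃ l : L2 a b →L[ℝ] ℝ, ∀ v, l v = ∫ t in Ioo a b, v t * φ t := by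
  have hm : MemLp φ 2 (lebesgueIoo a b) :=
    (hφ.continuous.memLp_of_hasCompactSupport hφ.2.1).restrict _
  refine ⟨innerSL ℝ (hm.toLp φ), fun v => ?_⟩
  rw [innerSL_apply_apply, real_inner_comm, ← (abs_integral_mul_le φ hm v).2]
  simp only [mul_comm]

theorem L2_eq_zero_of_integral (v : L2 a b)
    (h : ∀ φ, IsTestFunction a b φ → ∫ t in Ioo a b, v t * φ t = 0) : v = 0 := by
  rw [Lp.eq_zero_iff_ae_eq_zero]
  exact ae_eq_of_integral_mul_testFunction_eq (g := 0)
    ((Lp.memLp v).integrable (by norm_num)) (integrable_zero _ _ _)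
    (fun φ hφ => by simpa using h φ hφ)

/-- The Cauchy-Schwarz inequality for the integral over a subinterval. -/
theorem abs_intervalIntegral_le_sqrt {g : ℝ → ℝ} (hg : MemLp g 2 (lebesgueIoo a b)) {t₀ t : ℝ}
    (h₀ : a ≤ t₀) (h : t₀ ≤ t) (h₁ : t ≤ b) :
    |∫ τ in t₀..t, g τ| ≤ √(t - t₀) * ‖hg.toLp g‖ := by
  have hs : Ioo t₀ t ⊆ Ioo a b := Ioo_subset_Ioo h₀ h₁
  have hμ : (lebesgueIoo a b) (Ioo t₀ t) = ENNReal.ofReal (t - t₀) := by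
    rw [lebesgueIoo, Measure.restrict_apply measurableSet_Ioo, inter_eq_left.2 hs, Real.volume_Ioo]
  have h1 := L2.inner_indicatorConstLp_one (𝕜 := ℝ) (measurableSet_Ioo (a := t₀) (b := t))
    (by rw [hμ]; exact ENNReal.ofReal_ne_top) (hg.toLp g)
  have h2 : ∫ τ in Ioo t₀ t, (hg.toLp g) τ ∂lebesgueIoo a b = ∫ τ in t₀..t, g τ := by
    rw [Measure.restrict_restrict measurableSet_Ioo, inter_eq_left.2 hs,
      intervalIntegral.integral_of_le h, integral_Ioc_eq_integral_Ioo]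
    refine integral_congr_ae ?_
    exact ae_restrict_of_ae_restrict_of_subset hs hg.coeFn_toLp
  rw [← h2, ← h1]
  refine (abs_real_inner_le_norm _ _).trans (le_of_eq ?_)
  rw [norm_indicatorConstLp (by norm_num) (by norm_num), Measure.real, hμ,
    ENNReal.toReal_ofReal (sub_nonneg.2 h), Real.sqrt_eq_rpow]
  simp

end Continuous

/-! ### Smoothness of `Kx` and approximation by few dimensions -/

/-- The derivatives of order less than `m` of `Kx` are continuous linear functions of `x`, with
values in `C([a, b])`. -/
theorem exists_derivative_operators (hab : a < b) {m : ℕ} (hm : 1 ≤ m) {k : ℝ → ℝ → ℝ}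
    (hk : MemLp (Function.uncurry k) 2 ((lebesgueIoo a b).prod (lebesgueIoo a b)))
    (hK : ∀ x : L2 a b, MemSobolev a b m (fredholm a b k x)) :
    ∃ (v : ℕ → L2 a b →L[ℝ] C(Icc a b, ℝ)) (M : ℝ), 0 ≤ M ∧
      (∀ x (s : Icc a b), contRep a b (fredholm a b k x) s = v 0 x s) ∧
      (∀ x j, j + 1 < m → ∀ t₀ t : Icc a b, (t₀ : ℝ) ≤ t → ∀ C : ℝ,
        (∀ r : Icc a b, t₀ ≤ r → r ≤ t → |v (j + 1) x r| ≤ C) →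
          |v j x t - v j x t₀| ≤ C * (t - t₀)) ∧
      (∀ x, ∀ t₀ t : Icc a b, (t₀ : ℝ) ≤ t →
        |v (m - 1) x t - v (m - 1) x t₀| ≤ √(t - t₀) * (M * ‖x‖)) := by
  have hKi : ∀ x : L2 a b, IntegrableOn (fredholm a b k x) (Ioo a b) :=
    fun x => (hK x).1.integrable (by norm_num)
  have hg : ∀ x j, ∃ g : ℝ → ℝ, j ≤ m → MemLp g 2 (lebesgueIoo a b) ∧
      HasWeakDeriv a b j (fredholm a b k x) g := fun x j => by
    by_cases hj : j ≤ m
    · obtain ⟨g, h⟩ := (hK x).2 j hj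
      exact ⟨g, fun _ => h⟩
    · exact ⟨0, fun h => absurd h hj⟩
  choose g hg using hg
  have hgi : ∀ x j, j ≤ m → IntegrableOn (g x j) (Ioo a b) :=
    fun x j hj => (hg x j hj).1.integrable (by norm_num)
  have hgI : ∀ x j, j ≤ m → ∀ t₀ ∈ Icc a b, ∀ t ∈ Icc a b,
      IntervalIntegrable (g x j) volume t₀ t := fun x j hj t₀ h₀ t h => by
    refine ((intervalIntegrable_iff_integrableOn_Ioo_of_le hab.le).2 (hgi x j hj)).mono_set ?_
    rw [uIcc_of_le hab.le]
    exact ordConnected_Icc.uIcc_subset h₀ h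
  have hc : ∀ x j, ∃ c : ℝ, j < m →
      g x j =ᵐ[lebesgueIoo a b] fun t => c + ∫ τ in a..t, g x (j + 1) τ := fun x j => by
    by_cases hj : j < m
    · obtain ⟨c, h⟩ := exists_ae_eq_add_integral hab (hgi x j hj.le) (hgi x (j + 1) hj)
        (fun φ hφ => (hg x j hj.le).2.succ (hg x (j + 1) hj).2 hφ)
      exact ⟨c, fun _ => h⟩
    · exact ⟨0, fun h => absurd h hj⟩
  choose c hc using hc
  have hcont : ∀ x j, j < m →
      ContinuousOn (fun t => c x j + ∫ τ in a..t, g x (j + 1) τ) (Icc a b) := fun x j hj => by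
    have h1 := intervalIntegral.continuousOn_primitive_interval'
      (hgI x (j + 1) hj a (left_mem_Icc.2 hab.le) b (right_mem_Icc.2 hab.le)) left_mem_uIcc
    rw [uIcc_of_le hab.le] at h1
    exact continuousOn_const.add h1
  -- The continuous representative of the `j`-th weak derivative for `j < m`; zero is a filler for
  -- larger `j`.
  let V : ℕ → L2 a b → C(Icc a b, ℝ) := fun j x =>
    if hj : j < m then ⟨_, (hcont x j hj).domRestrict⟩ else 0
  have hV : ∀ x j, j < m → ∀ t : Icc a b, V j x t = c x j + ∫ τ in a..(t : ℝ), g x (j + 1) τ :=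
    fun x j hj t => by simp only [V, dif_pos hj]; rfl
  have hVae : ∀ x j, j < m → ∀ᵐ t ∂lebesgueIoo a b, V j x (projIcc a b hab.le t) = g x j t :=
    fun x j hj => by
      filter_upwards [hc x j hj, ae_restrict_mem measurableSet_Ioo] with t ht htm
      rw [hV x j hj, ht, projIcc_of_mem hab.le (Ioo_subset_Icc_self htm)]
  choose Λ hΛ using fun φ : {φ // IsTestFunction a b φ} => exists_functional hk hKi φ.2
  choose l hl using fun φ : {φ // IsTestFunction a b φ} => exists_functional_continuousMap hab φ.2
  choose l' hl' using fun φ : {φ // IsTestFunction a b φ} => exists_functional_L2 φ.2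
  -- All `j` derivatives are moved onto `φ`, so a tested derivative of `Kx` is a continuous
  -- functional of `x`. This is the weak continuity fed to the closed graph theorem.
  have hweak : ∀ x j, j ≤ m → ∀ φ : {φ // IsTestFunction a b φ},
      ∫ t in Ioo a b, g x j t * φ.1 t = (((-1 : ℝ) ^ j) • Λ ⟨_, φ.2.iteratedDeriv j⟩) x :=
    fun x j hj φ => by
      rw [smul_apply, hΛ, (hg x j hj).2 φ.1 φ.2.1 φ.2.2.1 φ.2.2.2, smul_eq_mul,
        ← mul_assoc, ← mul_pow]
      norm_num
  have hv : ∀ j, ∃ v : L2 a b →L[ℝ] C(Icc a b, ℝ), j < m → ∀ x, v x = V j x := fun j => by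
    by_cases hj : j < m
    · obtain ⟨v, h⟩ := exists_continuousLinearMap_of_separating l
        (fun u hu => continuousMap_eq_zero_of_integral hab u fun φ hφ => by
          rw [← hl ⟨φ, hφ⟩]; exact hu _)
        (fun φ => ((-1 : ℝ) ^ j) • Λ ⟨_, φ.2.iteratedDeriv j⟩) (V j) (fun φ x => by
          rw [hl, ← hweak x j hj.le]
          refine integral_congr_ae ?_
          filter_upwards [hVae x j hj] with t ht
          rw [ht])
      exact ⟨v, fun _ => h⟩
    · exact ⟨0, fun h => absurd h hj⟩
  choose v hv using hv
  -- The derivative of top order is only square integrable, so its continuity in `x` is obtained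
  -- with values in `L²`; `‖D‖` becomes the constant `M`.
  obtain ⟨D, hD⟩ := exists_continuousLinearMap_of_separating l'
    (fun u hu => L2_eq_zero_of_integral u fun φ hφ => by rw [← hl' ⟨φ, hφ⟩]; exact hu _)
    (fun φ => ((-1 : ℝ) ^ m) • Λ ⟨_, φ.2.iteratedDeriv m⟩)
    (fun x => (hg x m le_rfl).1.toLp) (fun φ x => by
      rw [hl', ← hweak x m le_rfl]
      refine integral_congr_ae ?_
      filter_upwards [(hg x m le_rfl).1.coeFn_toLp] with t ht
      rw [ht])
  have hdiff : ∀ x j, j < m → ∀ t₀ t : Icc a b,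
      v j x t - v j x t₀ = ∫ τ in (t₀ : ℝ)..t, g x (j + 1) τ := fun x j hj t₀ t => by
    rw [hv j hj, hV x j hj, hV x j hj, add_sub_add_left_eq_sub]
    exact intervalIntegral.integral_interval_sub_left
      (hgI x _ hj _ (left_mem_Icc.2 hab.le) _ t.2) (hgI x _ hj _ (left_mem_Icc.2 hab.le) _ t₀.2)
  refine ⟨v, ‖D‖, norm_nonneg _, fun x s => ?_, fun x j hj t₀ t h C hC => ?_,
    fun x t₀ t h => ?_⟩
  · have h1 : g x 0 =ᵐ[lebesgueIoo a b] fredholm a b k x :=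
      ae_eq_of_integral_mul_testFunction_eq (hgi x 0 m.zero_le) (hKi x) fun φ hφ => by
        have := (hg x 0 m.zero_le).2 φ hφ.1 hφ.2.1 hφ.2.2
        simpa using this.symm
    rw [contRep_eqOn hab (hcont x 0 hm) ((hc x 0 hm).symm.trans h1) s.2, hv 0 hm, hV x 0 hm]
  · rw [hdiff x j (by omega)]
    have hae : ∀ᵐ τ, τ ∈ uIoc (t₀ : ℝ) t → ‖g x (j + 1) τ‖ ≤ C := by
      have h1 := hVae x (j + 1) hj
      rw [lebesgueIoo, ae_restrict_iff' measurableSet_Ioo] at h1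
      have h2 : ∀ᵐ τ : ℝ, τ ≠ b := by simp [ae_iff, measure_singleton]
      filter_upwards [h1, h2] with τ h3 h4 h5
      rw [uIoc_of_le h] at h5
      have h6 : τ ∈ Icc a b := ⟨t₀.2.1.trans h5.1.le, h5.2.trans t.2.2⟩
      rw [← h3 ⟨t₀.2.1.trans_lt h5.1, lt_of_le_of_ne h6.2 h4⟩, ← hv _ hj,
        projIcc_of_mem hab.le h6]
      exact hC ⟨τ, h6⟩ h5.1.le h5.2
    have h1 := intervalIntegral.norm_integral_le_of_norm_le_const_ae hae
    rwa [abs_of_nonneg (sub_nonneg.2 h)] at h1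
  · have hm1 : m - 1 + 1 = m := by omega
    have h1 := hdiff x (m - 1) (by omega) t₀ t
    rw [hm1] at h1
    rw [h1]
    refine (abs_intervalIntegral_le_sqrt (hg x m le_rfl).1 t₀.2.1 h t.2.2).trans
      (mul_le_mul_of_nonneg_left ?_ (Real.sqrt_nonneg _))
    rw [← hD]
    exact D.le_opNorm x

/-- Repeated integration of the derivatives, all of which vanish at the left end point. -/
theorem abs_le_of_derivatives_eq_zero {m : ℕ} {u : ℕ → Icc a b → ℝ} {M : ℝ} (hM : 0 ≤ M)
    (h1 : ∀ j, j + 1 < m → ∀ t₀ t : Icc a b, (t₀ : ℝ) ≤ t → ∀ C : ℝ,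
      (∀ r : Icc a b, t₀ ≤ r → r ≤ t → |u (j + 1) r| ≤ C) → |u j t - u j t₀| ≤ C * (t - t₀))
    (h2 : ∀ t₀ t : Icc a b, (t₀ : ℝ) ≤ t → |u (m - 1) t - u (m - 1) t₀| ≤ √(t - t₀) * M)
    {t₀ : Icc a b} (h0 : ∀ j < m, u j t₀ = 0) {h : ℝ} (i : ℕ) (hi : i + 1 ≤ m) (t : Icc a b)
    (ht : (t₀ : ℝ) ≤ t) (hth : (t : ℝ) - t₀ ≤ h) :
    |u (m - 1 - i) t| ≤ h ^ i * √h * M := by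
  induction i generalizing t with
  | zero =>
    have h3 := h2 t₀ t ht
    rw [h0 _ (by omega), sub_zero] at h3
    rw [Nat.sub_zero, pow_zero, one_mul]
    exact h3.trans (mul_le_mul_of_nonneg_right (Real.sqrt_le_sqrt hth) hM)
  | succ i ih =>
    have hh : 0 ≤ h := (sub_nonneg.2 ht).trans hth
    have e : m - 1 - (i + 1) + 1 = m - 1 - i := by omega
    have h3 := h1 (m - 1 - (i + 1)) (by omega) t₀ t ht (h ^ i * √h * M) (by
      intro r hr hr'
      rw [e]
      exact ih (by omega) r hr ((sub_le_sub_right (Subtype.coe_le_coe.2 hr') _).trans hth))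
    rw [h0 _ (by omega), sub_zero] at h3
    calc _ ≤ _ := h3
      _ ≤ h ^ i * √h * M * h := mul_le_mul_of_nonneg_left hth (by positivity)
      _ = _ := by ring

/-- The points are `a + l (b - a) / N`, and a floor selects the last one not exceeding `s`. Index `l
= N` is needed for `s = b`. -/
theorem exists_grid_point (hab : a < b) {N : ℕ} (hN : 1 ≤ N) :
    ∃ t : Fin (N + 1) → Icc a b, ∀ s : Icc a b, ∃ l, (t l : ℝ) ≤ s ∧
      (s : ℝ) - t l ≤ (b - a) / N := by
  have hN0 : (0 : ℝ) < N := by exact_mod_cast hN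
  have hh : 0 < (b - a) / N := div_pos (sub_pos.2 hab) hN0
  have hNh : (N : ℝ) * ((b - a) / N) = b - a := by field_simp
  refine ⟨fun l => ⟨a + l * ((b - a) / N), ?_, ?_⟩, fun s => ?_⟩
  · have : (0 : ℝ) ≤ l := by positivity
    nlinarith
  · have : ((l : ℕ) : ℝ) ≤ N := by exact_mod_cast Nat.lt_succ_iff.1 l.2
    nlinarith
  · have hs : 0 ≤ ((s : ℝ) - a) / ((b - a) / N) := div_nonneg (sub_nonneg.2 s.2.1) hh.le
    have hle : ⌊((s : ℝ) - a) / ((b - a) / N)⌋₊ ≤ N := by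
      refine Nat.floor_le_of_le ?_
      rw [div_le_iff₀ hh, hNh]
      linarith [s.2.2]
    refine ⟨⟨_, Nat.lt_succ_iff.2 hle⟩, ?_, ?_⟩
    · have := Nat.floor_le hs
      rw [le_div_iff₀ hh] at this
      dsimp only; linarith
    · have := (Nat.lt_floor_add_one (((s : ℝ) - a) / ((b - a) / N))).le
      rw [div_le_iff₀ hh] at this
      dsimp only; linarith

/-- A finite family of continuous functionals vanishes on the orthogonal complement of a
subspace whose dimension is at most the number of functionals. -/
theorem exists_submodule_of_functionals {H ι : Type*} [Fintype ι] [NormedAddCommGroup H]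
    [InnerProductSpace ℝ H] [CompleteSpace H] (f : ι → H →L[ℝ] ℝ) :
    ∃ W : Submodule ℝ H, FiniteDimensional ℝ W ∧ Module.finrank ℝ W ≤ Fintype.card ι ∧
      ∀ x ∈ Wᗮ, ∀ i, f i x = 0 := by
  let r : ι → H := fun i => (InnerProductSpace.toDual ℝ H).symm (f i)
  refine ⟨Submodule.span ℝ (range r), FiniteDimensional.span_of_finite ℝ (finite_range r),
    finrank_range_le_card r, fun x hx i => ?_⟩
  rw [← InnerProductSpace.toDual_symm_apply]
  exact hx _ (Submodule.subset_span (mem_range_self i))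

/-- Point evaluation of `Kx` is continuous, and up to `m (N + 1)` dimensions it is small of order
`N^{-(m - 1/2)}`. -/
theorem exists_evaluation_operator (hab : a < b) {m : ℕ} (hm : 1 ≤ m) {k : ℝ → ℝ → ℝ}
    (hk : MemLp (Function.uncurry k) 2 ((lebesgueIoo a b).prod (lebesgueIoo a b)))
    (hK : ∀ x : L2 a b, MemSobolev a b m (fredholm a b k x)) :
    ∃ (u : L2 a b →L[ℝ] C(Icc a b, ℝ)) (M : ℝ), 0 ≤ M ∧
      (∀ x (s : Icc a b), contRep a b (fredholm a b k x) s = u x s) ∧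
      (∀ x s, |u x s| ≤ M * ‖x‖) ∧
      ∀ N : ℕ, 1 ≤ N → ∃ W : Submodule ℝ (L2 a b), FiniteDimensional ℝ W ∧
        Module.finrank ℝ W ≤ m * (N + 1) ∧
        ∀ x ∈ Wᗮ, ∀ s, |u x s| ≤ M * √((N : ℝ) ^ (2 * m - 1))⁻¹ * ‖x‖ := by
  obtain ⟨v, M, hM, hv0, hv1, hv2⟩ := exists_derivative_operators hab hm hk hK
  have hba : 0 ≤ b - a := (sub_pos.2 hab).le
  have hM' : 0 ≤ √((b - a) ^ (2 * m - 1)) * M := by positivity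
  refine ⟨v 0, ‖v 0‖ + √((b - a) ^ (2 * m - 1)) * M, by positivity, hv0, fun x s => ?_,
    fun N hN => ?_⟩
  · calc |v 0 x s| ≤ ‖v 0 x‖ := (v 0 x).norm_coe_le_norm s
      _ ≤ ‖v 0‖ * ‖x‖ := (v 0).le_opNorm x
      _ ≤ _ := mul_le_mul_of_nonneg_right (by linarith) (norm_nonneg _)
  · obtain ⟨t, ht⟩ := exists_grid_point hab hN
    -- `x ∈ Wᗮ` means that every derivative of `Kx` of order below `m` vanishes at every grid point.
    obtain ⟨W, hW, hdim, hWx⟩ := exists_submodule_of_functionals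
      (fun p : Fin m × Fin (N + 1) => (ContinuousMap.evalCLM ℝ (t p.2)) ∘L (v p.1))
    refine ⟨W, hW, by simpa using hdim, fun x hx s => ?_⟩
    obtain ⟨l, hl1, hl2⟩ := ht s
    have h1 := abs_le_of_derivatives_eq_zero (u := fun j => v j x) (M := M * ‖x‖) (by positivity)
      (hv1 x) (hv2 x) (t₀ := t l) (fun j hj => hWx x hx (⟨j, hj⟩, l)) (m - 1) (by omega) s hl1 hl2
    rw [Nat.sub_self] at h1
    have hN0 : (0 : ℝ) < N := by exact_mod_cast hN
    have hh : 0 ≤ (b - a) / N := by positivity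
    -- Both sides are `((b - a) / N)^{m - 1/2}`.
    have e : ((b - a) / N) ^ (m - 1) * √((b - a) / N) =
        √((b - a) ^ (2 * m - 1)) * √((N : ℝ) ^ (2 * m - 1))⁻¹ := by
      rw [← Real.sqrt_mul (by positivity), ← div_eq_mul_inv, ← div_pow]
      have : 2 * m - 1 = (m - 1) * 2 + 1 := by omega
      rw [this, pow_succ, pow_mul, Real.sqrt_mul (by positivity),
        Real.sqrt_sq (by positivity)]
    rw [e] at h1
    refine h1.trans ?_
    have h2 : 0 ≤ ‖v 0‖ * (√((N : ℝ) ^ (2 * m - 1))⁻¹ * ‖x‖) := by positivity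
    linarith

/-- The effective dimension of the sampled Tikhonov problem is of the order `α^{-1/(2m)}`. -/
theorem sum_norm_sq_le_rpow {m : ℕ} (hm : 1 ≤ m) (u : L2 a b →L[ℝ] C(Icc a b, ℝ)) {M : ℝ}
    (hM : 0 ≤ M) (hu : ∀ x s, |u x s| ≤ M * ‖x‖)
    (hN : ∀ N : ℕ, 1 ≤ N → ∃ W : Submodule ℝ (L2 a b), FiniteDimensional ℝ W ∧
        Module.finrank ℝ W ≤ m * (N + 1) ∧
        ∀ x ∈ Wᗮ, ∀ s, |u x s| ≤ M * √((N : ℝ) ^ (2 * m - 1))⁻¹ * ‖x‖)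
    {n : ℕ} (hn : 1 ≤ n) (s : Fin n → Icc a b) (R : L2 a b →L[ℝ] EuclideanSpace ℝ (Fin n))
    (hR : ∀ x i, R x i = (√n)⁻¹ * u x (s i)) {α : ℝ} (hα : 0 < α)
    (X : EuclideanSpace ℝ (Fin n) →L[ℝ] L2 a b)
    (hX : ∀ w, ‖R (X w)‖ ^ 2 + α * ‖X w‖ ^ 2 = ⟪R (X w), w⟫_ℝ) :
    ∑ i, ‖R (X (EuclideanSpace.basisFun (Fin n) ℝ i))‖ ^ 2 ≤
      (3 * m + M ^ 2 / 4) * α ^ (-(1 / (2 * (m : ℝ)))) := by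
  have hn0 : (0 : ℝ) < n := by exact_mod_cast hn
  have hm0 : (1 : ℝ) ≤ m := by exact_mod_cast hm
  have hsn : 0 < √(n : ℝ) := Real.sqrt_pos.2 hn0
  have hRle : ∀ {x : L2 a b} {ε : ℝ}, (∀ s, |u x s| ≤ ε * ‖x‖) →
      ∀ i, |R x i| ≤ (√n)⁻¹ * ε * ‖x‖ := fun h i => by
    rw [hR, abs_mul, abs_of_pos (inv_pos.2 hsn), mul_assoc]
    exact mul_le_mul_of_nonneg_left (h _) (inv_pos.2 hsn).le
  -- The normalization of `R` cancels the factor `n`, so the bound is independent of the number of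
  -- samples.
  have hδ : ∀ ε : ℝ, n * ((√n)⁻¹ * ε) ^ 2 / (4 * α) = ε ^ 2 / (4 * α) := fun ε => by
    rw [mul_pow, inv_pow, Real.sq_sqrt hn0.le, ← mul_assoc, mul_inv_cancel₀ hn0.ne', one_mul]
  set β := α ^ (-(1 / (2 * (m : ℝ)))) with hβ
  have hβ0 : 0 < β := Real.rpow_pos_of_pos hα _
  -- For `α ≤ 1` the choice `N = ⌈β⌉` balances dimension and remainder, as `α β^{2m} = 1`. For `α ≥
  -- 1` the trivial subspace suffices, because `α⁻¹ ≤ β`.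
  rcases le_total α 1 with h1 | h1
  · have hβ1 : 1 ≤ β := by
      refine Real.one_le_rpow_of_pos_of_le_one_of_nonpos hα h1 ?_
      rw [neg_nonpos]; positivity
    have hβα : α * β ^ (2 * m) = 1 := by
      rw [hβ, ← Real.rpow_natCast, ← Real.rpow_mul hα.le]
      have : -(1 / (2 * (m : ℝ))) * ((2 * m : ℕ) : ℝ) = -1 := by push_cast; field_simp
      rw [this, Real.rpow_neg_one, mul_inv_cancel₀ hα.ne']
    have hN1 : 1 ≤ ⌈β⌉₊ := Nat.one_le_ceil_iff.2 hβ0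
    obtain ⟨W, hW, hdim, hWx⟩ := hN ⌈β⌉₊ hN1
    have hle := Nat.le_ceil β
    have hlt := Nat.ceil_lt_add_one hβ0.le
    set N : ℝ := (⌈β⌉₊ : ℝ) with hNdef
    have hN0 : 0 < N := hβ0.trans_le hle
    refine (sum_norm_sq_tikhonov_le R hα X hX W (by positivity)
      (fun x hx => hRle (hWx x hx))).trans ?_
    rw [hδ, mul_pow, Real.sq_sqrt (by positivity)]
    -- The factor 3 comes from `N + 1 ≤ β + 2 ≤ 3 β`.
    have hA : (Module.finrank ℝ W : ℝ) ≤ 3 * m * β := by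
      calc (Module.finrank ℝ W : ℝ) ≤ ((m * (⌈β⌉₊ + 1) : ℕ) : ℝ) := by exact_mod_cast hdim
        _ = m * (N + 1) := by push_cast; rfl
        _ ≤ _ := by nlinarith
    have hB : (N ^ (2 * m - 1))⁻¹ ≤ β * α := by
      calc (N ^ (2 * m - 1))⁻¹ ≤ (β ^ (2 * m - 1))⁻¹ :=
            inv_anti₀ (by positivity) (pow_le_pow_left₀ hβ0.le hle _)
        _ = β * α := by
            refine inv_eq_of_mul_eq_one_left ?_
            have : 2 * m = 2 * m - 1 + 1 := by omega
            rw [this, pow_succ] at hβα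
            linarith
    calc _ ≤ 3 * m * β + M ^ 2 * (β * α) / (4 * α) := by gcongr
      _ = _ := by field_simp
  · have h2 := sum_norm_sq_tikhonov_le R hα X hX ⊥ (δ := (√n)⁻¹ * M) (by positivity)
      (fun x _ => hRle (hu x))
    rw [hδ, finrank_bot, Nat.cast_zero, zero_add] at h2
    refine h2.trans ?_
    have hβα : α⁻¹ ≤ β := by
      rw [← Real.rpow_neg_one]
      refine Real.rpow_le_rpow_of_exponent_le h1 (neg_le_neg ?_)
      rw [div_le_one (by positivity)]; linarith
    calc M ^ 2 / (4 * α) = M ^ 2 / 4 * α⁻¹ := by field_simp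
      _ ≤ M ^ 2 / 4 * β := by gcongr
      _ ≤ _ := by
        have : 0 ≤ 3 * (m : ℝ) * β := by positivity
        linarith

/-! ### Bias, variance and the a priori choice of `α` -/

/-- Bias-variance decomposition for a linear image of independent centred noise. -/
theorem integral_norm_add_sq_le {n : ℕ} {F Ω : Type*} [NormedAddCommGroup F]
    [InnerProductSpace ℝ F] [MeasurableSpace Ω] (P : Measure Ω) [IsProbabilityMeasure P]
    (e : Fin n → Ω → ℝ) (hind : iIndepFun e P) (h2 : ∀ i, MemLp (e i) 2 P)
    (h0 : ∀ i, ∫ ξ, e i ξ ∂P = 0) {σ : ℝ} (hσ : ∀ i, variance (e i) P ≤ σ ^ 2)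
    (c : F) (f : Fin n → F) :
    Integrable (fun ξ => ‖c + ∑ i, e i ξ • f i‖ ^ 2) P ∧
      ∫ ξ, ‖c + ∑ i, e i ξ • f i‖ ^ 2 ∂P ≤ ‖c‖ ^ 2 + σ ^ 2 * ∑ i, ‖f i‖ ^ 2 := by
  have hexp : (fun ξ => ‖c + ∑ i, e i ξ • f i‖ ^ 2) = fun ξ =>
      (‖c‖ ^ 2 + ∑ i, 2 * ⟪c, f i⟫_ℝ * e i ξ) + ∑ i, ∑ j, ⟪f i, f j⟫_ℝ * (e i ξ * e j ξ) := by
    ext ξ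
    rw [norm_add_sq_real, ← real_inner_self_eq_norm_sq (∑ i, e i ξ • f i), inner_sum,
      Finset.mul_sum, sum_inner]
    congr 1
    · congr 1
      refine Finset.sum_congr rfl fun i _ => ?_
      rw [real_inner_smul_right]; ring
    · refine Finset.sum_congr rfl fun i _ => ?_
      rw [inner_sum]
      refine Finset.sum_congr rfl fun j _ => ?_
      rw [real_inner_smul_left, real_inner_smul_right]; ring
  have hi1 : ∀ i, Integrable (e i) P := fun i => (h2 i).integrable (by norm_num)
  have hi2 : ∀ i j, Integrable (fun ξ => e i ξ * e j ξ) P := fun i j =>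
    (h2 i).integrable_mul (h2 j)
  have hA : Integrable (fun ξ => ∑ i, 2 * ⟪c, f i⟫_ℝ * e i ξ) P :=
    integrable_finsetSum _ fun i _ => (hi1 i).const_mul _
  have hB : Integrable (fun ξ => ∑ i, ∑ j, ⟪f i, f j⟫_ℝ * (e i ξ * e j ξ)) P :=
    integrable_finsetSum _ fun i _ => integrable_finsetSum _ fun j _ => (hi2 i j).const_mul _
  have hA' : Integrable (fun ξ => ‖c‖ ^ 2 + ∑ i, 2 * ⟪c, f i⟫_ℝ * e i ξ) P :=
    (integrable_const _).add hA
  rw [hexp]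
  refine ⟨hA'.add hB, ?_⟩
  rw [integral_add hA' hB, integral_add (integrable_const _) hA,
    integral_finsetSum _ fun i _ => (hi1 i).const_mul _,
    integral_finsetSum _ fun i _ => integrable_finsetSum _ fun j _ => (hi2 i j).const_mul _]
  have hlin : ∑ i, ∫ ξ, 2 * ⟪c, f i⟫_ℝ * e i ξ ∂P = 0 :=
    Finset.sum_eq_zero fun i _ => by rw [integral_const_mul, h0, mul_zero]
  rw [hlin, integral_const, probReal_univ, one_smul, add_zero, Finset.mul_sum]
  -- In each row of the double sum only the diagonal term survives: off the diagonal, independence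
  -- factors the expectation into zero means.
  refine add_le_add_right (Finset.sum_le_sum fun i _ => ?_) _
  rw [integral_finsetSum _ fun j _ => (hi2 i j).const_mul _, Finset.sum_eq_single i]
  · rw [integral_const_mul, real_inner_self_eq_norm_sq, mul_comm]
    refine mul_le_mul_of_nonneg_right ?_ (sq_nonneg _)
    have := hσ i
    rw [variance_of_integral_eq_zero (h2 i).1.aemeasurable (h0 i)] at this
    simpa [sq] using this
  · intro j _ hj
    rw [integral_const_mul]
    have := (hind.indepFun hj.symm).integral_mul_eq_mul_integral (h2 i).1 (h2 j).1
    simp only [Pi.mul_apply] at this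
    rw [show ∫ ξ, e i ξ * e j ξ ∂P = 0 by
      refine Eq.trans ?_ (this.trans ?_)
      · rfl
      · rw [h0, zero_mul], mul_zero]
  · simp

/-- The balance of bias and variance for the a priori choice of `α`. -/
theorem bias_add_variance_le {m : ℕ} (hm : 1 ≤ m) {c₁ c₂ C τ ρ α : ℝ} (hc₁ : 0 < c₁) (hc₂ : 0 < c₂)
    (hC : 0 ≤ C) (hτ : 0 < τ) (hρ : 0 < ρ) (hα : 0 < α)
    (h1 : c₁ * (τ * ρ⁻¹) ≤ α ^ ((1 / 2 : ℝ) + 1 / (4 * (m : ℝ))))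
    (h2 : α ^ ((1 / 2 : ℝ) + 1 / (4 * (m : ℝ))) ≤ c₂ * (τ * ρ⁻¹)) :
    α * ρ ^ 2 + τ ^ 2 * (C * α ^ (-(1 / (2 * (m : ℝ))))) ≤
      ((1 + C / c₁ ^ 2) * c₂ ^ (4 * (m : ℝ) / (1 + 2 * (m : ℝ)))) *
        (τ ^ (4 * (m : ℝ) / (1 + 2 * (m : ℝ))) * ρ ^ (2 / (1 + 2 * (m : ℝ)))) := by
  have hm0 : (1 : ℝ) ≤ m := by exact_mod_cast hm
  set p : ℝ := 1 / 2 + 1 / (4 * (m : ℝ)) with hp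
  set q : ℝ := 4 * (m : ℝ) / (1 + 2 * (m : ℝ)) with hq
  set β := α ^ (-(1 / (2 * (m : ℝ)))) with hβ
  have hq0 : 0 ≤ q := by positivity
  have hpq : p * q = 1 := by rw [hp, hq]; field_simp; ring
  -- The lower bound on `α ^ p` is squared, and `2p - 1/(2m) = 1` gives `(α ^ p)² β = α`.
  have hvar : τ ^ 2 * (C * β) ≤ C / c₁ ^ 2 * (α * ρ ^ 2) := by
    have h3 : (c₁ * (τ * ρ⁻¹)) ^ 2 * β ≤ α := by
      calc (c₁ * (τ * ρ⁻¹)) ^ 2 * β ≤ (α ^ p) ^ 2 * β := by gcongr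
        _ = α := by
          rw [hβ, ← Real.rpow_natCast, ← Real.rpow_mul hα.le, ← Real.rpow_add hα]
          have : p * ((2 : ℕ) : ℝ) + -(1 / (2 * (m : ℝ))) = 1 := by
            rw [hp]; push_cast; field_simp; ring
          rw [this, Real.rpow_one]
    calc τ ^ 2 * (C * β) = C / c₁ ^ 2 * ((c₁ * (τ * ρ⁻¹)) ^ 2 * β * ρ ^ 2) := by field_simp
      _ ≤ C / c₁ ^ 2 * (α * ρ ^ 2) := by gcongr
  -- The upper bound on `α ^ p` is raised to the power `q = 1/p`; the exponent of `ρ` is `2 - q =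
  -- 2/(1 + 2m)`.
  have hbias : α * ρ ^ 2 ≤ c₂ ^ q * (τ ^ q * ρ ^ (2 / (1 + 2 * (m : ℝ)))) := by
    have h3 : α ≤ c₂ ^ q * (τ ^ q * ρ ^ (-q)) := by
      calc α = (α ^ p) ^ q := by rw [← Real.rpow_mul hα.le, hpq, Real.rpow_one]
        _ ≤ (c₂ * (τ * ρ⁻¹)) ^ q := Real.rpow_le_rpow (by positivity) h2 hq0
        _ = _ := by
          rw [Real.mul_rpow hc₂.le (by positivity), Real.mul_rpow hτ.le (by positivity),
            Real.inv_rpow hρ.le, Real.rpow_neg hρ.le]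
    have h4 : ρ ^ (-q) * ρ ^ 2 = ρ ^ (2 / (1 + 2 * (m : ℝ))) := by
      rw [← Real.rpow_natCast, ← Real.rpow_add hρ]
      congr 1
      rw [hq]; push_cast; field_simp; ring
    calc α * ρ ^ 2 ≤ c₂ ^ q * (τ ^ q * ρ ^ (-q)) * ρ ^ 2 := by gcongr
      _ = _ := by rw [← h4]; ring
  calc _ ≤ α * ρ ^ 2 + C / c₁ ^ 2 * (α * ρ ^ 2) := by gcongr
    _ = (1 + C / c₁ ^ 2) * (α * ρ ^ 2) := by ring
    _ ≤ (1 + C / c₁ ^ 2) * (c₂ ^ q * (τ ^ q * ρ ^ (2 / (1 + 2 * (m : ℝ))))) := by gcongr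
    _ = _ := by ring

/-- A best-approximate solution for attainable continuous data is an exact solution. -/
theorem IsBestApproxSolution.contRep_eqOn (hab : a < b) {k : ℝ → ℝ → ℝ} {y : ℝ → ℝ}
    (hK : ∀ x : L2 a b, MemLp (fredholm a b k x) 2 (lebesgueIoo a b))
    (hy : ContinuousOn y (Icc a b)) (hex : ∃ x, fredholm a b k x =ᵐ[lebesgueIoo a b] y)
    {x : L2 a b} (hx : IsBestApproxSolution a b k y x) :
    EqOn (contRep a b (fredholm a b k x)) y (Icc a b) := by
  obtain ⟨z, hz⟩ := hex
  have h1 := hx.1 z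
  have h2 : eLpNorm (fredholm a b k z - y) 2 (lebesgueIoo a b) = 0 := by
    rw [eLpNorm_congr_ae (g := 0) (by filter_upwards [hz] with t ht; simp [ht])]
    simp
  rw [h2, nonpos_iff_eq_zero, eLpNorm_eq_zero_iff ?_ (by norm_num)] at h1
  · refine Fredholm.contRep_eqOn hab hy ?_
    filter_upwards [h1] with t ht
    exact (sub_eq_zero.1 ht).symm
  · exact (hK x).1.sub ((hy.mono Ioo_subset_Icc_self).aestronglyMeasurable measurableSet_Ioo)

/-! ### Reduction of the sampled problem to the Hilbert space setting -/

theorem empNorm_sq {n : ℕ} (w : Fin n → ℝ) :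
    empNorm w ^ 2 = ‖(√n)⁻¹ • (WithLp.toLp 2 w : EuclideanSpace ℝ (Fin n))‖ ^ 2 := by
  rw [empNorm, Real.sq_sqrt (mul_nonneg (by positivity)
    (Finset.sum_nonneg fun i _ => sq_nonneg _)), norm_smul, mul_pow, EuclideanSpace.norm_sq_eq]
  simp

/-- The operator of normalized point evaluations. -/
theorem exists_sampling_operator {n : ℕ} (u : L2 a b →L[ℝ] C(Icc a b, ℝ)) (s : Fin n → Icc a b) :
    ∃ R : L2 a b →L[ℝ] EuclideanSpace ℝ (Fin n), ∀ x i, R x i = (√n)⁻¹ * u x (s i) :=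
  ⟨(EuclideanSpace.equiv (Fin n) ℝ).symm.toContinuousLinearMap ∘L
    ContinuousLinearMap.pi fun i => (√n)⁻¹ • (ContinuousMap.evalCLM ℝ (s i) ∘L u),
    fun _ _ => rfl⟩

/-- The minimizer of the Tikhonov functional is the solution of the normal equation. -/
theorem regSolution_eq {k : ℝ → ℝ → ℝ} {n : ℕ} {s : Fin n → ℝ} {α : ℝ} (hα : 0 < α)
    (R : L2 a b →L[ℝ] EuclideanSpace ℝ (Fin n))
    (hR : ∀ x, R x = (√n)⁻¹ • WithLp.toLp 2 (sample a b k s x))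
    (X : EuclideanSpace ℝ (Fin n) →L[ℝ] L2 a b)
    (hX : ∀ w z, ‖R z - w‖ ^ 2 + α * ‖z‖ ^ 2 = ‖R (X w) - w‖ ^ 2 + α * ‖X w‖ ^ 2 +
        (‖R (z - X w)‖ ^ 2 + α * ‖z - X w‖ ^ 2)) (w : Fin n → ℝ) :
    regSolution a b k s α w = X ((√n)⁻¹ • WithLp.toLp 2 w) := by
  set w' : EuclideanSpace ℝ (Fin n) := (√n)⁻¹ • WithLp.toLp 2 w with hw'
  have hJ : ∀ z, tikhonov a b k s α w z = ‖R z - w'‖ ^ 2 + α * ‖z‖ ^ 2 := fun z => by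
    rw [tikhonov, empNorm_sq, WithLp.toLp_sub, smul_sub, hR]
  have hmin : ∀ z, tikhonov a b k s α w (X w') ≤ tikhonov a b k s α w z := fun z => by
    rw [hJ, hJ, hX w' z]
    have : 0 ≤ ‖R (z - X w')‖ ^ 2 + α * ‖z - X w'‖ ^ 2 := by positivity
    linarith
  have h1 : ∀ z, tikhonov a b k s α w (regSolution a b k s α w) ≤ tikhonov a b k s α w z :=
    Classical.epsilon_spec (p := fun x => ∀ z : L2 a b,
      tikhonov a b k s α w x ≤ tikhonov a b k s α w z) ⟨X w', hmin⟩
  have h2 := h1 (X w')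
  -- Any minimizer has the same value as `X w'`, and quadratic growth with `α > 0` then forces it to
  -- coincide with `X w'`.
  rw [hJ, hJ, hX w' (regSolution a b k s α w)] at h2
  set d := regSolution a b k s α w - X w' with hd
  have h3 : ‖d‖ ^ 2 = 0 := by nlinarith [sq_nonneg ‖R d‖, sq_nonneg ‖d‖]
  exact sub_eq_zero.1 (by simpa using h3)

end Fredholm

end

open Fredholm in
theorem mainTheorem5 (a b : ℝ) (hab : a < b) (m : ℕ) (hm : 1 ≤ m) (k : ℝ → ℝ → ℝ)
    (hk : MemLp (Function.uncurry k) 2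
      ((Fredholm.lebesgueIoo a b).prod (Fredholm.lebesgueIoo a b)))
    (hK : ∀ x : Fredholm.L2 a b, Fredholm.MemSobolev a b m (Fredholm.fredholm a b k x))
    (B c₁ c₂ : ℝ) (hc₁ : 0 < c₁) (hc₂ : 0 < c₂) :
    ∃ C : ℝ, 0 < C ∧
      ∀ (n : ℕ) (_ : 1 ≤ n) (s : Fin n → ℝ) (_ : Fredholm.QuasiUniform a b B s)
        (y : ℝ → ℝ) (_ : ContinuousOn y (Icc a b))
        (_ : ∃ x : Fredholm.L2 a b,
          Fredholm.fredholm a b k x =ᵐ[Fredholm.lebesgueIoo a b] y)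
        (xdag : Fredholm.L2 a b) (_ : Fredholm.IsBestApproxSolution a b k y xdag)
        (_ : xdag ≠ 0) (σ : ℝ) (_ : 0 < σ)
        (Ω : Type*) [MeasurableSpace Ω] (P : Measure Ω) [IsProbabilityMeasure P]
        (e : Fin n → Ω → ℝ) (_ : iIndepFun e P) (_ : ∀ i, MemLp (e i) 2 P)
        (_ : ∀ i, ∫ ξ, e i ξ ∂P = 0) (_ : ∀ i, variance (e i) P ≤ σ ^ 2)
        (α : ℝ) (_ : 0 < α)
        (_ : c₁ * (σ * (n : ℝ) ^ (-(1 / 2) : ℝ) * ‖xdag‖⁻¹) ≤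
          α ^ ((1 / 2 : ℝ) + 1 / (4 * (m : ℝ))))
        (_ : α ^ ((1 / 2 : ℝ) + 1 / (4 * (m : ℝ))) ≤
          c₂ * (σ * (n : ℝ) ^ (-(1 / 2) : ℝ) * ‖xdag‖⁻¹)),
        Integrable (fun ξ => Fredholm.empNorm
          (Fredholm.sample a b k s
              (Fredholm.regSolution a b k s α (fun i => y (s i) + e i ξ)) -
            Fredholm.sample a b k s xdag) ^ 2) P ∧
        ∫ ξ, Fredholm.empNorm
          (Fredholm.sample a b k s
              (Fredholm.regSolution a b k s α (fun i => y (s i) + e i ξ)) -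
            Fredholm.sample a b k s xdag) ^ 2 ∂P ≤
          C * ((σ * (n : ℝ) ^ (-(1 / 2) : ℝ)) ^ (4 * (m : ℝ) / (1 + 2 * (m : ℝ))) *
            ‖xdag‖ ^ (2 / (1 + 2 * (m : ℝ)))) := by
  obtain ⟨u, M, hM, hu0, hu1, hu2⟩ := exists_evaluation_operator hab hm hk hK
  have hC₁ : 0 ≤ 3 * (m : ℝ) + M ^ 2 / 4 := by positivity
  refine ⟨(1 + (3 * (m : ℝ) + M ^ 2 / 4) / c₁ ^ 2) * c₂ ^ (4 * (m : ℝ) / (1 + 2 * (m : ℝ))),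
    by positivity, ?_⟩
  intro n hn s hs y hy hex xdag hxdag hx0 σ hσ Ω _ P _ e hind he2 he0 hvar α hα hlo hhi
  have hn0 : (0 : ℝ) < n := by exact_mod_cast hn
  let s' : Fin n → Icc a b := fun i => ⟨s i, hs.2.1 i⟩
  obtain ⟨R, hR⟩ := exists_sampling_operator u s'
  obtain ⟨X, hX1, hX2⟩ := exists_tikhonov_solution R hα
  have hRs : ∀ x, R x = (√n)⁻¹ • WithLp.toLp 2 (sample a b k s x) := fun x => by
    ext i
    rw [hR, ← hu0]
    rfl
  have hdim := sum_norm_sq_le_rpow hm u hM hu1 hu2 hn s' R hR hα X hX2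
  have hyK : ∀ i, sample a b k s xdag i = y (s i) := fun i =>
    hxdag.contRep_eqOn hab (fun x => (hK x).1) hy hex (hs.2.1 i)
  let ε : Fin n → EuclideanSpace ℝ (Fin n) := EuclideanSpace.basisFun (Fin n) ℝ
  let c := R (X (R xdag)) - R xdag
  let f : Fin n → EuclideanSpace ℝ (Fin n) := fun i => (√n)⁻¹ • R (X (ε i))
  -- The exact part of the data is `R xdag`, since `K xdag` agrees with `y` at the sample points.
  have hdata : ∀ ξ, (√n)⁻¹ • WithLp.toLp 2 (fun i => y (s i) + e i ξ) =
      R xdag + (√n)⁻¹ • ∑ i, e i ξ • ε i := fun ξ => by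
    rw [hRs, ← smul_add]
    congr 1
    have h1 : ∑ i, e i ξ • ε i = WithLp.toLp 2 (fun i => e i ξ) :=
      (EuclideanSpace.basisFun (Fin n) ℝ).sum_repr (WithLp.toLp 2 fun i => e i ξ)
    rw [h1, ← WithLp.toLp_add]
    congr 1
    ext i
    rw [Pi.add_apply, hyK]
  have herr : ∀ ξ, empNorm (sample a b k s (regSolution a b k s α (fun i => y (s i) + e i ξ)) -
      sample a b k s xdag) ^ 2 = ‖c + ∑ i, e i ξ • f i‖ ^ 2 := fun ξ => by
    rw [empNorm_sq, WithLp.toLp_sub, smul_sub, ← hRs, ← hRs, regSolution_eq hα R hRs X hX1, hdata]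
    congr 2
    simp only [c, f, map_add, map_smul, map_sum, Finset.smul_sum]
    rw [add_sub_right_comm]
    congr 1
    exact Finset.sum_congr rfl fun i _ => smul_comm _ _ _
  simp only [herr]
  obtain ⟨hint, hle⟩ := integral_norm_add_sq_le P e hind he2 he0 hvar c f
  refine ⟨hint, hle.trans ?_⟩
  -- For the exact data `R xdag` the competitor `xdag` has zero residual, so the minimal Tikhonov
  -- value is at most `α ‖xdag‖²`.
  have hc : ‖c‖ ^ 2 ≤ α * ‖xdag‖ ^ 2 := by
    have h1 := hX1 (R xdag) xdag
    rw [sub_self, norm_zero] at h1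
    have h2 : 0 ≤ α * ‖X (R xdag)‖ ^ 2 +
      (‖R (xdag - X (R xdag))‖ ^ 2 + α * ‖xdag - X (R xdag)‖ ^ 2) := by positivity
    have h3 : ‖c‖ ^ 2 = ‖R (X (R xdag)) - R xdag‖ ^ 2 := rfl
    linarith
  have hτ : (σ * (n : ℝ) ^ (-(1 / 2) : ℝ)) ^ 2 = σ ^ 2 / n := by
    rw [mul_pow, ← Real.rpow_natCast ((n : ℝ) ^ (-(1 / 2) : ℝ)), ← Real.rpow_mul hn0.le]
    norm_num [Real.rpow_neg_one, div_eq_mul_inv]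
  have hf : σ ^ 2 * ∑ i, ‖f i‖ ^ 2 ≤ (σ * (n : ℝ) ^ (-(1 / 2) : ℝ)) ^ 2 *
      ((3 * (m : ℝ) + M ^ 2 / 4) * α ^ (-(1 / (2 * (m : ℝ))))) := by
    have h1 : ∑ i, ‖f i‖ ^ 2 = (n : ℝ)⁻¹ * ∑ i, ‖R (X (ε i))‖ ^ 2 := by
      rw [Finset.mul_sum]
      refine Finset.sum_congr rfl fun i _ => ?_
      rw [norm_smul, mul_pow, norm_inv, inv_pow, Real.norm_eq_abs, sq_abs, Real.sq_sqrt hn0.le]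
    rw [h1, hτ, div_eq_mul_inv, mul_assoc]
    gcongr
  refine (add_le_add hc hf).trans ?_
  exact bias_add_variance_le hm hc₁ hc₂ hC₁ (mul_pos hσ (Real.rpow_pos_of_pos hn0 _))
    (norm_pos_iff.2 hx0) hα hlo hhi
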